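/- Let $M \subseteq \mathcal{B}(\mathcal{H})$ be a von Neumann algebra with a faithful normal semifinite trace $\tau$, and let $r \in M$ be a nonzero projection. A linear functional on the reduced algebra $M_r := rMr$ is called normal if it is ultraweakly continuous, and a positive linear functional $\varphi$ on $M_r$ is called singular if the only positive normal linear functional $\psi$ on $M_r$ with $\varphi - \psi \ge 0$ is $\psi = 0$. Let $K$ be a weak*-compact convex set of positive functionals in the closed unit ball of the Banach space dual $M^*$ such that the restriction $\mu|_{M_r}$ is singular for every $\mu \in K$. Then for every nonzero projection $f \in M_r$ there is a nonzero projection $p \in M$ with $p \le f$ such that $\mu(p) = 0$ for all $\mu \in K$. -/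

import Mathlib

namespace VNA

open scoped ComplexOrder ENNReal NNReal InnerProductSpace

variable {H : Type*} [NormedAddCommGroup H] [InnerProductSpace ℂ H] [CompleteSpace H]

/-- The elements of a von Neumann algebra `M ⊆ B(H)` as a type, with the operator norm and the
Loewner order of `B(H)`. -/
abbrev Elem (M : VonNeumannAlgebra H) : Type _ := M.toStarSubalgebra

/-- A faithful normal semifinite trace on `M`. A trace is a map `M₊ → [0, ∞]`; only the values
of `τ` at positive elements matter. -/
structure IsFNSTrace (M : VonNeumannAlgebra H) (τ : Elem M → ℝ≥0∞) : Prop where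
  add : ∀ x y : Elem M, 0 ≤ x → 0 ≤ y → τ (x + y) = τ x + τ y
  smul : ∀ (c : ℝ≥0) (x : Elem M), 0 ≤ x → τ (((c : ℝ) : ℂ) • x) = (c : ℝ≥0∞) * τ x
  tracial : ∀ x : Elem M, τ (star x * x) = τ (x * star x)
  faithful : ∀ x : Elem M, 0 ≤ x → τ x = 0 → x = 0
  normal : ∀ (D : Set (Elem M)) (x : Elem M), D.Nonempty → DirectedOn (· ≤ ·) D →
    (∀ d ∈ D, 0 ≤ d) → IsLUB D x → IsLUB (τ '' D) (τ x)
  semifinite : ∀ x : Elem M, 0 ≤ x → x ≠ 0 → ∃ y : Elem M, 0 ≤ y ∧ y ≤ x ∧ y ≠ 0 ∧ τ y < ∞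

/-- The ultraweak (`σ`-weak) topology on `M`: the coarsest topology for which all the functionals
`x ↦ ∑ₙ ⟪ξₙ, x ηₙ⟫` with `∑ₙ ‖ξₙ‖² < ∞`, `∑ₙ ‖ηₙ‖² < ∞` are continuous. -/
@[reducible]
noncomputable def ultraweakTopology (M : VonNeumannAlgebra H) : TopologicalSpace (Elem M) :=
  ⨅ (ξ : ℕ → H) (η : ℕ → H) (_ : Summable fun n => ‖ξ n‖ ^ 2) (_ : Summable fun n => ‖η n‖ ^ 2),
    TopologicalSpace.induced (fun x : Elem M => ∑' n, ⟪ξ n, (x : H →L[ℂ] H) (η n)⟫_ℂ) inferInstance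

/-- The reduced algebra `M_r = r M r` of a projection `r` of `M`. -/
def corner (M : VonNeumannAlgebra H) (r : Elem M) (hr : IsStarProjection r) :
    NonUnitalStarSubalgebra ℂ (Elem M) where
  carrier := {x | ∃ y : Elem M, x = r * y * r}
  add_mem' := by
    rintro _ _ ⟨a, rfl⟩ ⟨b, rfl⟩
    exact ⟨a + b, by rw [mul_add, add_mul]⟩
  zero_mem' := ⟨0, by simp⟩
  mul_mem' := by
    rintro _ _ ⟨a, rfl⟩ ⟨b, rfl⟩
    exact ⟨a * r * r * b, by simp only [mul_assoc]⟩
  smul_mem' := by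
    rintro c _ ⟨a, rfl⟩
    exact ⟨c • a, by simp⟩
  star_mem' := by
    rintro _ ⟨a, rfl⟩
    exact ⟨star a, by simp [hr.isSelfAdjoint.star_eq, mul_assoc]⟩

section Functionals

variable {M : VonNeumannAlgebra H} {N : NonUnitalStarSubalgebra ℂ (Elem M)}

/-- Positivity of a linear functional on a `*`-subalgebra `N` of `M`. -/
def IsPositive (φ : N →ₗ[ℂ] ℂ) : Prop := ∀ x : N, 0 ≤ φ (star x * x)

/-- Normality of a linear functional on a `*`-subalgebra `N` of `M`: continuity for the ultraweak
topology. On `r M r` the ultraweak topology of its action on `r H` is the one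
inherited from `M`. -/
def IsNormal (φ : N →ₗ[ℂ] ℂ) : Prop :=
  @Continuous N ℂ ((ultraweakTopology M).induced Subtype.val) inferInstance φ

/-- A positive functional is singular if it dominates no nonzero positive normal functional. -/
def IsSingular (φ : N →ₗ[ℂ] ℂ) : Prop :=
  IsPositive φ ∧ ∀ ψ : N →ₗ[ℂ] ℂ, IsPositive ψ → IsNormal ψ → IsPositive (φ - ψ) → ψ = 0

/-- The restriction of a bounded functional on `M` to `N`. -/
noncomputable def restrict (N : NonUnitalStarSubalgebra ℂ (Elem M)) (μ : WeakDual ℂ (Elem M)) : N →ₗ[ℂ] ℂ where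
  toFun x := μ (x : Elem M)
  map_add' x y := map_add μ (x : Elem M) (y : Elem M)
  map_smul' c x := map_smul μ c (x : Elem M)

end Functionals

/-- The positive functionals in the closed unit ball of `M*`. -/
def positiveUnitBall (M : VonNeumannAlgebra H) : Set (WeakDual ℂ (Elem M)) :=
  {μ | ‖WeakDual.toStrongDual μ‖ ≤ 1 ∧ ∀ x : Elem M, 0 ≤ μ (star x * x)}

end VNA

/-!
A singular functional `φ` and a vector functional `ω = ⟪ξ, · ξ⟫` can be separated. Given `a ≥ 0`,
a maximal `x ≤ a` with `ω x ≤ φ x` leaves `h = a - x` with `φ ≤ ω` on `[0, h]`. Then `φ (· h)` is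
bounded by the vector seminorm of `h ξ`, so Riesz gives a vector `η` with `φ h = ⟪η, h ξ⟫` whose
vector functional is dominated by `φ`; singularity makes it vanish, so `h η = 0` and `φ h = 0`.
Applied to large multiples of `ω`, this yields `0 ≤ h ≤ a` with `φ h = 0` and `ω (a - h)` as small
as desired.

Sion's minimax theorem on the compact convex set `K` makes the choice uniform, at the price of
`μ h < δ` instead of `μ h = 0`. Repeating with geometrically decreasing errors gives a decreasing
sequence below `f` on which `ω` stays bounded away from zero; its strong limit is a nonzero element
of `[0, f]` annihilated by all of `K`, and a spectral projection of that element is the required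
projection.
-/

namespace VNA

open scoped ComplexOrder InnerProductSpace Topology
open Filter

theorem re_map_mono {E : Type*} [AddCommMonoid E] [PartialOrder E] [Module ℂ E] (φ : E →ₚ[ℂ] ℂ)
    {x y : E} (h : x ≤ y) : (φ x).re ≤ (φ y).re :=
  (OrderHomClass.mono φ h).1

section CStarAlgebra

variable {A : Type*} [CStarAlgebra A] [PartialOrder A] [StarOrderedRing A]

theorem mul_self_le_norm_smul {a : A} (ha : 0 ≤ a) : a * a ≤ ‖a‖ • a := by
  obtain ⟨s, hs, rfl⟩ : ∃ s : A, 0 ≤ s ∧ s * s = a :=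
    ⟨CFC.sqrt a, CFC.sqrt_nonneg a, CFC.sqrt_mul_sqrt_self a ha⟩
  simpa only [hs.star_eq, mul_assoc] using
    CStarAlgebra.star_left_conjugate_le_norm_smul (a := s) (b := s * s)

theorem star_mul_self_mul_le_smul {h : A} (hh : 0 ≤ h) (y : A) :
    star (y * h) * (y * h) ≤ (‖star y * y‖ * ‖h‖) • h :=
  calc star (y * h) * (y * h) = star h * (star y * y) * h := by simp only [star_mul, mul_assoc]
    _ ≤ ‖star y * y‖ • (star h * h) := CStarAlgebra.star_left_conjugate_le_norm_smul
    _ ≤ ‖star y * y‖ • (‖h‖ • h) := by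
      rw [hh.star_eq]
      exact smul_le_smul_of_nonneg_left (mul_self_le_norm_smul hh) (norm_nonneg _)
    _ = (‖star y * y‖ * ‖h‖) • h := smul_smul _ _ _

theorem smul_le_of_mul_posPart_eq {x p : A} (hx : 0 ≤ x) (hp : IsStarProjection p) (c : ℝ)
    (hpos : p * (x - c • 1)⁺ = (x - c • 1)⁺) (hneg : (x - c • 1)⁻ * p = 0) : c • p ≤ x := by
  have hd : IsSelfAdjoint (x - c • 1) := hx.isSelfAdjoint.sub (.smul (.all c) (.one A))
  have hdecomp : x = c • 1 + ((x - c • 1)⁺ - (x - c • 1)⁻) := by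
    rw [CFC.posPart_sub_negPart _ hd, add_sub_cancel]
  have hpos0 : 0 ≤ (x - c • 1)⁺ := CFC.posPart_nonneg _
  have hneg0 : 0 ≤ (x - c • 1)⁻ := CFC.negPart_nonneg _
  generalize (x - c • 1)⁺ = u, (x - c • 1)⁻ = v at *
  have hpos' : u * p = u := by
    simpa only [star_mul, hp.isSelfAdjoint.star_eq, hpos0.star_eq] using congr(star $hpos)
  have hneg' : p * v = 0 := by
    simpa only [star_mul, hp.isSelfAdjoint.star_eq, hneg0.star_eq, star_zero] using
      congr(star $hneg)
  have hsplit : x - c • p = u + (1 - p) * x * (1 - p) := by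
    rw [hdecomp]
    simp only [mul_add, add_mul, mul_sub, sub_mul, mul_one, one_mul, smul_mul_assoc, mul_smul_comm,
      hp.isIdempotentElem.eq, hpos, hpos', hneg, hneg', smul_sub, sub_zero]
    abel
  rw [← sub_nonneg, hsplit]
  refine add_nonneg hpos0 ?_
  simpa only [hp.one_sub.isSelfAdjoint.star_eq] using star_left_conjugate_nonneg hx (1 - p)

theorem le_of_smul_le_projection {f p : A} (hf : IsStarProjection f) (hp : IsStarProjection p)
    {c : ℝ} (hc : 0 < c) (h : c • p ≤ f) : p ≤ f := by
  have hpf := (hf.mul_right_and_mul_left_of_nonneg_of_le (smul_nonneg hc.le hp.nonneg) h).1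
  rw [smul_mul_assoc] at hpf
  exact (hp.le_iff_mul_eq_left hf).2 (smul_right_injective _ hc.ne' hpf)

theorem re_map_le_of_le_smul {φ ψ : A →ₚ[ℂ] ℂ} {h : A}
    (hle : ∀ y, 0 ≤ y → y ≤ h → (φ y).re ≤ (ψ y).re) {c : ℝ} (hc : 0 < c) {y : A}
    (hy : 0 ≤ y) (hyh : y ≤ c • h) : (φ y).re ≤ (ψ y).re := by
  have hscaled := hle (c⁻¹ • y) (smul_nonneg (inv_nonneg.2 hc.le) hy)
    ((inv_smul_le_iff_of_pos hc).2 hyh)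
  simp only [PositiveLinearMap.map_smul_of_tower, Complex.smul_re, smul_eq_mul] at hscaled
  exact le_of_mul_le_mul_left hscaled (inv_pos.2 hc)

theorem map_star_mul_self (φ : A →ₚ[ℂ] ℂ) (z : A) :
    φ (star z * z) = ((‖φ.toPreGNS z‖ ^ 2 : ℝ) : ℂ) := by
  rw [Complex.ofReal_pow]
  exact (φ.preGNS_norm_sq (φ.toPreGNS z)).symm

end CStarAlgebra

variable {H : Type*} [NormedAddCommGroup H] [InnerProductSpace ℂ H] [CompleteSpace H]
variable {M : VonNeumannAlgebra H}

theorem mem_of_forall_commute {x : H →L[ℂ] H} (h : ∀ y ∈ M.commutant, Commute x y) : x ∈ M := by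
  rw [← M.commutant_commutant, VonNeumannAlgebra.mem_commutant_iff]
  exact fun y hy => (h y hy).symm

theorem commute_of_mem {x y : H →L[ℂ] H} (hx : x ∈ M) (hy : y ∈ M.commutant) : Commute x y :=
  VonNeumannAlgebra.mem_commutant_iff.1 hy x hx

scoped instance isClosed_elem : IsClosed (M.toStarSubalgebra : Set (H →L[ℂ] H)) := by
  change IsClosed M.carrier
  rw [← M.centralizer_centralizer']
  exact Set.isClosed_centralizer _

scoped instance starOrderedRing_elem : StarOrderedRing (Elem M) :=
  .of_nonneg_iff' (fun h z => add_le_add_right (α := H →L[ℂ] H) h z) fun a => by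
    refine ⟨fun (ha : 0 ≤ (a : H →L[ℂ] H)) => ?_, ?_⟩
    · have hs : CFC.sqrt (a : H →L[ℂ] H) ∈ M :=
        mem_of_forall_commute fun y hy => (commute_of_mem a.2 hy).cfcₙ_nnreal _
      refine ⟨⟨_, hs⟩, Subtype.ext ?_⟩
      change (a : H →L[ℂ] H) = star (CFC.sqrt (a : H →L[ℂ] H)) * CFC.sqrt (a : H →L[ℂ] H)
      rw [(CFC.sqrt_nonneg _).star_eq, CFC.sqrt_mul_sqrt_self _ ha]
    · rintro ⟨s, rfl⟩
      exact star_mul_self_nonneg (s : H →L[ℂ] H)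

theorem exists_inner_eq_of_norm_le {V : Type*} [AddCommGroup V] [Module ℂ V] (L : V →ₗ[ℂ] H)
    (g : V →ₗ[ℂ] ℂ) {c : ℝ} (h : ∀ v, ‖g v‖ ≤ c * ‖L v‖) :
    ∃ η ∈ L.range.topologicalClosure, ∀ v, g v = ⟪η, L v⟫_ℂ := by
  let U := L.range.topologicalClosure
  let L' : V →ₗ[ℂ] U := L.codRestrict U fun v => L.range.le_topologicalClosure ⟨v, rfl⟩
  have hL' : DenseRange L' := by
    refine dense_iff_closure_eq.2 (Set.eq_univ_of_forall fun u => ?_)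
    rw [closure_subtype, ← Set.range_comp]
    exact u.2
  let η : U := (InnerProductSpace.toDual ℂ U).symm (g.extendOfNorm L')
  refine ⟨η, η.2, fun v => ?_⟩
  calc g v = g.extendOfNorm L' (L' v) := (g.extendOfNorm_eq hL' ⟨c, h⟩ v).symm
    _ = ⟪η, L' v⟫_ℂ := (InnerProductSpace.toDual_symm_apply).symm

theorem norm_le_of_forall_norm_inner_le {E : Type*} [NormedAddCommGroup E] [InnerProductSpace ℂ E]
    {U : Submodule ℂ E} {w : E} (hw : w ∈ U.topologicalClosure) {c : ℝ} (hc : 0 ≤ c)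
    (h : ∀ u ∈ U, ‖⟪w, u⟫_ℂ‖ ≤ c * ‖u‖) : ‖w‖ ≤ c := by
  have hclosed : IsClosed {u : E | ‖⟪w, u⟫_ℂ‖ ≤ c * ‖u‖} := isClosed_le (by fun_prop) (by fun_prop)
  have hself : ‖⟪w, w⟫_ℂ‖ ≤ c * ‖w‖ := closure_minimal h hclosed hw
  rw [inner_self_eq_norm_sq_to_K, norm_pow, RCLike.norm_ofReal, abs_norm, sq] at hself
  rcases (norm_nonneg w).eq_or_lt with hw0 | hw0
  · rwa [← hw0]
  · exact le_of_mul_le_mul_right hself hw0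

/-- The vector functional `x ↦ ⟪ξ, x ξ⟫`, as a positive functional on `M`. -/
noncomputable def vectorFunctional (M : VonNeumannAlgebra H) (ξ : H) : Elem M →ₚ[ℂ] ℂ :=
  .mk₀
    { toFun := fun x => ⟪ξ, (x : H →L[ℂ] H) ξ⟫_ℂ
      map_add' := fun x y => inner_add_right ξ ((x : H →L[ℂ] H) ξ) ((y : H →L[ℂ] H) ξ)
      map_smul' := fun c x => inner_smul_right ξ ((x : H →L[ℂ] H) ξ) c }
    fun x hx => (show (x : H →L[ℂ] H).IsPositive by
      rw [← ContinuousLinearMap.nonneg_iff_isPositive]; exact hx).inner_nonneg_right ξ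

theorem vectorFunctional_apply (ξ : H) (x : Elem M) :
    vectorFunctional M ξ x = ⟪ξ, (x : H →L[ℂ] H) ξ⟫_ℂ :=
  rfl

theorem vectorFunctional_star_mul_self (ξ : H) (x : Elem M) :
    vectorFunctional M ξ (star x * x) = ((‖(x : H →L[ℂ] H) ξ‖ ^ 2 : ℝ) : ℂ) := by
  change ⟪ξ, star (x : H →L[ℂ] H) ((x : H →L[ℂ] H) ξ)⟫_ℂ = _
  rw [ContinuousLinearMap.star_eq_adjoint, ContinuousLinearMap.adjoint_inner_right,
    inner_self_eq_norm_sq_to_K]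
  norm_cast

theorem norm_apply_sq_le {a : Elem M} (ha : 0 ≤ a) (v : H) :
    ‖(a : H →L[ℂ] H) v‖ ^ 2 ≤ ‖a‖ * (vectorFunctional M v a).re := by
  have h := re_map_mono (vectorFunctional M v) (mul_self_le_norm_smul ha)
  nth_rw 1 [← ha.star_eq] at h
  rwa [vectorFunctional_star_mul_self, Complex.ofReal_re, PositiveLinearMap.map_smul_of_tower,
    Complex.smul_re] at h

theorem exists_re_vectorFunctional_pos {a : Elem M} (ha0 : 0 ≤ a) (hne : a ≠ 0) :
    ∃ ξ, 0 < (vectorFunctional M ξ a).re := by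
  contrapose! hne
  refine Subtype.ext (ContinuousLinearMap.ext fun ξ => ?_)
  have h := (norm_apply_sq_le ha0 ξ).trans
    (mul_nonpos_of_nonneg_of_nonpos (norm_nonneg a) (hne ξ))
  exact norm_eq_zero.1 (pow_eq_zero_iff two_ne_zero |>.1 (le_antisymm h (sq_nonneg _)))

section MonotoneConvergence

variable {ι : Type*} [Preorder ι] [IsDirectedOrder ι] [Nonempty ι] {x : ι → Elem M} {b : Elem M}

theorem cauchy_apply_of_monotone (hx : Monotone x) (hx0 : ∀ i, 0 ≤ x i) (hb : ∀ i, x i ≤ b)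
    (v : H) : Cauchy (atTop.map fun i => (x i : H →L[ℂ] H) v) := by
  let F : ι → ℝ := fun i => (vectorFunctional M v (x i)).re
  have hF : Monotone F := fun i j hij => re_map_mono _ (hx hij)
  have hFb : BddAbove (Set.range F) :=
    ⟨_, Set.forall_mem_range.2 fun i => re_map_mono (vectorFunctional M v) (hb i)⟩
  have hdist {i j : ι} (hij : i ≤ j) :
      dist ((x j : H →L[ℂ] H) v) ((x i : H →L[ℂ] H) v) ^ 2 ≤ ‖b‖ * ((⨆ k, F k) - F i) := by
    have hnonneg : 0 ≤ x j - x i := sub_nonneg.2 (hx hij)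
    have hnorm : ‖x j - x i‖ ≤ ‖b‖ := CStarAlgebra.norm_le_norm_of_nonneg_of_le hnonneg
      ((sub_le_self _ (hx0 i)).trans (hb j))
    calc _ = ‖((x j - x i : Elem M) : H →L[ℂ] H) v‖ ^ 2 := by rw [dist_eq_norm]; rfl
      _ ≤ ‖x j - x i‖ * (F j - F i) := by
        simpa only [map_sub, Complex.sub_re] using norm_apply_sq_le hnonneg v
      _ ≤ ‖b‖ * ((⨆ k, F k) - F i) := by
        gcongr
        · exact sub_nonneg.2 (hF hij)
        · exact le_ciSup hFb j
  refine Metric.cauchy_iff.2 ⟨inferInstance, fun ε hε => ?_⟩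
  have hlim : Tendsto (fun i => ‖b‖ * ((⨆ k, F k) - F i)) atTop (𝓝 0) := by
    simpa using ((tendsto_atTop_ciSup hF hFb).const_sub (⨆ k, F k)).const_mul ‖b‖
  obtain ⟨i, hi⟩ := (hlim.eventually_lt_const (show 0 < (ε / 2) ^ 2 by positivity)).exists
  have hball : ∀ᶠ j in atTop, dist ((x j : H →L[ℂ] H) v) ((x i : H →L[ℂ] H) v) < ε / 2 :=
    (eventually_ge_atTop i).mono fun j hij =>
      lt_of_pow_lt_pow_left₀ 2 (half_pos hε).le ((hdist hij).trans_lt hi)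
  refine ⟨Metric.ball ((x i : H →L[ℂ] H) v) (ε / 2), hball, fun y hy z hz => ?_⟩
  exact (dist_triangle_right _ _ _).trans_lt ((add_lt_add hy hz).trans_eq (add_halves ε))

theorem exists_tendsto_of_monotone (hx : Monotone x) (hx0 : ∀ i, 0 ≤ x i) (hb : ∀ i, x i ≤ b) :
    ∃ y : Elem M, ∀ v, Tendsto (fun i => (x i : H →L[ℂ] H) v) atTop
      (𝓝 ((y : H →L[ℂ] H) v)) := by
  choose y hy using fun v => CompleteSpace.complete (cauchy_apply_of_monotone hx hx0 hb v)
  have hlim (v : H) : Tendsto (fun i => (x i : H →L[ℂ] H) v) atTop (𝓝 (y v)) := hy v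
  let Y : H →ₗ[ℂ] H :=
    { toFun := y
      map_add' := fun v w => tendsto_nhds_unique (hlim _) <| by
        simpa only [map_add] using (hlim v).add (hlim w)
      map_smul' := fun c v => tendsto_nhds_unique (hlim _) <| by
        simpa only [map_smul, RingHom.id_apply] using (hlim v).const_smul c }
  let Y' : H →L[ℂ] H := Y.mkContinuous ‖b‖ fun v => le_of_tendsto' (hlim v).norm fun i =>
    (x i : H →L[ℂ] H).le_of_opNorm_le
      (CStarAlgebra.norm_le_norm_of_nonneg_of_le (hx0 i) (hb i)) v
  have hY' : Y' ∈ M := mem_of_forall_commute fun z hz => by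
    ext v
    refine tendsto_nhds_unique (hlim (z v)) ?_
    refine ((z.continuous.tendsto (y v)).comp (hlim v)).congr fun i => ?_
    exact congr($((commute_of_mem (x i).2 hz).eq) v).symm
  exact ⟨⟨Y', hY'⟩, hlim⟩

theorem nonneg_iff_forall_vectorFunctional {a : Elem M} :
    0 ≤ a ↔ ∀ v, 0 ≤ vectorFunctional M v a := by
  refine ⟨fun h v => (vectorFunctional M v).map_nonneg h, fun h => ?_⟩
  change 0 ≤ (a : H →L[ℂ] H)
  rw [ContinuousLinearMap.nonneg_iff_isPositive, ContinuousLinearMap.isPositive_iff_complex]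
  intro v
  have hv := h v
  rw [vectorFunctional_apply, ← inner_conj_symm, starRingEnd_apply, star_nonneg_iff] at hv
  obtain ⟨c, hc, hcv⟩ := RCLike.nonneg_iff_exists_ofReal.1 hv
  simpa [← hcv] using hc

theorem isLUB_of_monotone_of_tendsto (hx : Monotone x) {y : Elem M}
    (hy : ∀ v, Tendsto (fun i => (x i : H →L[ℂ] H) v) atTop (𝓝 ((y : H →L[ℂ] H) v))) :
    IsLUB (Set.range x) y := by
  have hlim (v : H) :
      Tendsto (fun i => vectorFunctional M v (x i)) atTop (𝓝 (vectorFunctional M v y)) :=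
    tendsto_const_nhds.inner (hy v)
  have hle {a b : Elem M} : a ≤ b ↔ ∀ v, vectorFunctional M v a ≤ vectorFunctional M v b := by
    rw [← sub_nonneg, nonneg_iff_forall_vectorFunctional]
    simp only [map_sub, sub_nonneg]
  refine ⟨Set.forall_mem_range.2 fun i => hle.2 fun v => ?_, fun z hz => hle.2 fun v => ?_⟩
  · exact ge_of_tendsto (hlim v) ((eventually_ge_atTop i).mono fun j hij =>
      OrderHomClass.mono _ (hx hij))
  · exact le_of_tendsto' (hlim v) fun i => OrderHomClass.mono _ (hz ⟨i, rfl⟩)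

end MonotoneConvergence

theorem exists_isGLB_tendsto_of_antitone {x : ℕ → Elem M} (hx : Antitone x) (hx0 : ∀ n, 0 ≤ x n) :
    ∃ y, IsGLB (Set.range x) y ∧
      ∀ v, Tendsto (fun n => (x n : H →L[ℂ] H) v) atTop (𝓝 ((y : H →L[ℂ] H) v)) := by
  have hmono : Monotone fun n => x 0 - x n := fun m n h => sub_le_sub_left (hx h) _
  obtain ⟨z, hz⟩ := exists_tendsto_of_monotone hmono (fun n => sub_nonneg.2 (hx n.zero_le))
    (fun n => sub_le_self (x 0) (hx0 n))
  have hlub := isLUB_of_monotone_of_tendsto hmono hz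
  refine ⟨x 0 - z, ⟨Set.forall_mem_range.2 fun n => sub_le_comm.1 (hlub.1 ⟨n, rfl⟩), fun w hw =>
    le_sub_comm.1 (hlub.2 (Set.forall_mem_range.2 fun n => sub_le_sub_left (hw ⟨n, rfl⟩) _))⟩,
    fun v => ?_⟩
  simpa using (hz v).const_sub ((x 0 : H →L[ℂ] H) v)

theorem exists_inner_eq_of_norm_toPreGNS_le (φ : Elem M →ₚ[ℂ] ℂ) {h : Elem M} {ζ : H}
    (hle : ∀ y : Elem M, ‖φ.toPreGNS (y * h)‖ ≤ ‖(y : H →L[ℂ] H) ζ‖) :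
    ∃ η : H, φ h = ⟪η, ζ⟫_ℂ ∧ ∀ z : Elem M, ‖(z : H →L[ℂ] H) η‖ ≤ ‖φ.toPreGNS z‖ := by
  have hbound (z y : Elem M) :
      ‖φ (star z * (y * h))‖ ≤ ‖φ.toPreGNS z‖ * ‖(y : H →L[ℂ] H) ζ‖ :=
    (norm_inner_le_norm (𝕜 := ℂ) (φ.toPreGNS z) (φ.toPreGNS (y * h))).trans
      (mul_le_mul_of_nonneg_left (hle y) (norm_nonneg _))
  let L : Elem M →ₗ[ℂ] H :=
    { toFun := fun y => (y : H →L[ℂ] H) ζ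
      map_add' := fun _ _ => rfl
      map_smul' := fun _ _ => rfl }
  obtain ⟨η, hη, hrep⟩ := exists_inner_eq_of_norm_le L
    (φ.toLinearMap ∘ₗ LinearMap.mulRight ℂ h) fun y => by simpa [L] using hbound 1 y
  refine ⟨η, by simpa [L] using hrep 1, fun z => norm_le_of_forall_norm_inner_le (U := L.range) ?_
    (norm_nonneg _) ?_⟩
  · refine map_mem_closure (z : H →L[ℂ] H).continuous hη ?_
    rintro _ ⟨y, rfl⟩
    exact ⟨z * y, rfl⟩
  · rintro _ ⟨y, rfl⟩
    have hzy : ⟪(z : H →L[ℂ] H) η, L y⟫_ℂ = φ (star z * (y * h)) := by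
      rw [← mul_assoc]
      exact (ContinuousLinearMap.adjoint_inner_right _ _ _).symm.trans (hrep (star z * y)).symm
    rw [hzy]
    exact hbound z y

/- If `x` is maximal with `x ≤ a` and `ω_ξ x ≤ φ x`, then no `0 < y ≤ a - x` satisfies
`ω_ξ y ≤ φ y`, since otherwise `x + y` would contradict maximality. -/
theorem exists_le_forall_map_le_vectorFunctional (φ : Elem M →ₚ[ℂ] ℂ) {a : Elem M} (ha : 0 ≤ a)
    (ξ : H) : ∃ h, 0 ≤ h ∧ h ≤ a ∧ (vectorFunctional M ξ (a - h)).re ≤ (φ a).re ∧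
      ∀ y, 0 ≤ y → y ≤ h → (φ y).re ≤ (vectorFunctional M ξ y).re := by
  let S : Set (Elem M) := {x | 0 ≤ x ∧ x ≤ a ∧ (vectorFunctional M ξ x).re ≤ (φ x).re}
  have hchain : ∀ c ⊆ S, IsChain (· ≤ ·) c → ∃ ub ∈ S, ∀ z ∈ c, z ≤ ub := by
    intro c hcS hc
    rcases c.eq_empty_or_nonempty with rfl | hne
    · exact ⟨0, ⟨le_rfl, ha, by simp⟩, by simp⟩
    have : Nonempty c := hne.to_subtype
    have : IsDirectedOrder c := ⟨hc.directed⟩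
    have hmono : Monotone (Subtype.val : c → Elem M) := fun _ _ h => h
    obtain ⟨y, hy⟩ := exists_tendsto_of_monotone hmono (fun i => (hcS i.2).1)
      fun i => (hcS i.2).2.1
    have hlub : IsLUB (Set.range ((↑) : c → Elem M)) y := isLUB_of_monotone_of_tendsto hmono hy
    obtain ⟨i⟩ := ‹Nonempty c›
    refine ⟨y, ⟨(hcS i.2).1.trans (hlub.1 ⟨i, rfl⟩),
      hlub.2 (Set.forall_mem_range.2 fun j => (hcS j.2).2.1), ?_⟩,
      fun z hz => hlub.1 ⟨⟨z, hz⟩, rfl⟩⟩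
    refine le_of_tendsto' ((Complex.continuous_re.tendsto _).comp
      (tendsto_const_nhds.inner (hy ξ))) fun j => ?_
    exact (hcS j.2).2.2.trans (re_map_mono φ (hlub.1 ⟨j, rfl⟩))
  obtain ⟨x, ⟨hx0, hxa, hxle⟩, hmax⟩ := zorn_le₀ S hchain
  refine ⟨a - x, sub_nonneg.2 hxa, sub_le_self a hx0, ?_, fun y hy hyh => ?_⟩
  · rw [sub_sub_cancel]
    exact hxle.trans (re_map_mono φ hxa)
  · by_contra! hlt
    have hxy : x + y ≤ x := hmax ⟨add_nonneg hx0 hy, le_sub_iff_add_le'.1 hyh, by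
      simpa only [map_add, Complex.add_re] using add_le_add hxle hlt.le⟩ (le_add_of_nonneg_right hy)
    have hy0 : y = 0 := le_antisymm (by simpa using hxy) hy
    simp [hy0] at hlt

theorem exists_inner_eq_vectorFunctional_le {φ : Elem M →ₚ[ℂ] ℂ} {h : Elem M} {ξ : H}
    (hh : 0 ≤ h) (hle : ∀ y, 0 ≤ y → y ≤ h → (φ y).re ≤ (vectorFunctional M ξ y).re) :
    ∃ η : H, φ h = ⟪η, (h : H →L[ℂ] H) ξ⟫_ℂ ∧
      ∀ z : Elem M, vectorFunctional M η (star z * z) ≤ φ (star z * z) := by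
  have hnorm (y : Elem M) : ‖φ.toPreGNS (y * h)‖ ≤ ‖(y : H →L[ℂ] H) ((h : H →L[ℂ] H) ξ)‖ := by
    have hscaled : star (y * h) * (y * h) ≤ (‖star y * y‖ * ‖h‖ + 1) • h :=
      (star_mul_self_mul_le_smul hh y).trans (smul_le_smul_of_nonneg_right (by simp) hh)
    have hdom := re_map_le_of_le_smul hle (by positivity) (star_mul_self_nonneg (y * h)) hscaled
    rw [map_star_mul_self, vectorFunctional_star_mul_self, Complex.ofReal_re,
      Complex.ofReal_re] at hdom
    exact le_of_sq_le_sq hdom (norm_nonneg _)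
  obtain ⟨η, hη, hηle⟩ := exists_inner_eq_of_norm_toPreGNS_le φ hnorm
  refine ⟨η, hη, fun z => ?_⟩
  rw [vectorFunctional_star_mul_self, map_star_mul_self, Complex.real_le_real]
  exact pow_le_pow_left₀ (norm_nonneg _) (hηle z) 2

section Corner

variable {r : Elem M} {hr : IsStarProjection r} {a x : Elem M}

theorem mul_mul_eq_of_mem_corner (ha : a ∈ corner M r hr) : r * a * r = a := by
  obtain ⟨y, rfl⟩ := ha
  simp only [mul_assoc, hr.isIdempotentElem.eq]
  simp only [← mul_assoc, hr.isIdempotentElem.eq]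

theorem mul_eq_self_of_star_mul_self_le (ha : a ∈ corner M r hr) (hxa : star x * x ≤ a) :
    x * r = x := by
  have hcompl : star (1 - r) * a * (1 - r) = 0 := by
    rw [← mul_mul_eq_of_mem_corner ha, star_sub, hr.isSelfAdjoint.star_eq, star_one]
    simp only [mul_assoc, hr.isIdempotentElem.mul_one_sub_self, mul_zero]
  have hle : star (x * (1 - r)) * (x * (1 - r)) ≤ 0 := by
    simpa only [star_mul, mul_assoc, hcompl] using star_left_conjugate_le_conjugate hxa (1 - r)
  have hzero : x * (1 - r) = 0 := CStarRing.star_mul_self_eq_zero_iff _ |>.1 <|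
    le_antisymm hle (star_mul_self_nonneg _)
  rw [mul_sub, mul_one, sub_eq_zero] at hzero
  exact hzero.symm

theorem exists_mem_corner_star_mul_self_eq (ha : a ∈ corner M r hr) (hx : 0 ≤ x) (hxa : x ≤ a) :
    ∃ s ∈ corner M r hr, star s * s = x := by
  have hstar : star (CFC.sqrt x) = CFC.sqrt x := (CFC.sqrt_nonneg x).star_eq
  have hs : star (CFC.sqrt x) * CFC.sqrt x = x := by rw [hstar, CFC.sqrt_mul_sqrt_self x hx]
  have hright := mul_eq_self_of_star_mul_self_le ha (hs.trans_le hxa)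
  refine ⟨CFC.sqrt x, ⟨CFC.sqrt x, ?_⟩, hs⟩
  have hleft := congr(star $hright)
  rw [star_mul, hstar, hr.isSelfAdjoint.star_eq] at hleft
  rw [hleft, hright]

theorem mem_corner_of_le (ha : a ∈ corner M r hr) (hx : 0 ≤ x) (hxa : x ≤ a) :
    x ∈ corner M r hr := by
  obtain ⟨s, hs, rfl⟩ := exists_mem_corner_star_mul_self_eq ha hx hxa
  exact mul_mem (star_mem hs) hs

theorem IsPositive.map_nonneg {φ : corner M r hr →ₗ[ℂ] ℂ} (hφ : IsPositive φ)
    {x : corner M r hr} (hx : 0 ≤ (x : Elem M)) : 0 ≤ φ x := by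
  obtain ⟨s, hs, hsx⟩ := exists_mem_corner_star_mul_self_eq x.2 hx le_rfl
  exact (hφ ⟨s, hs⟩).trans_eq (congrArg φ (Subtype.ext hsx))

theorem IsPositive.map_mono {φ : corner M r hr →ₗ[ℂ] ℂ} (hφ : IsPositive φ)
    {x y : corner M r hr} (h : (x : Elem M) ≤ y) : φ x ≤ φ y := by
  rw [← sub_nonneg, ← map_sub]
  exact hφ.map_nonneg (sub_nonneg.2 h)

/-- The extension `x ↦ φ (r x r)` to `M` of a positive functional `φ` on `r M r`. -/
noncomputable def compression (φ : corner M r hr →ₗ[ℂ] ℂ) (hφ : IsPositive φ) :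
    Elem M →ₚ[ℂ] ℂ :=
  .mk₀
    (φ ∘ₗ (LinearMap.mulRight ℂ r ∘ₗ LinearMap.mulLeft ℂ r).codRestrict
      (corner M r hr).toSubmodule fun x => ⟨x, rfl⟩)
    fun x hx => hφ.map_nonneg (x := ⟨r * x * r, x, rfl⟩) <| by
      have hrx := star_left_conjugate_nonneg hx r
      rwa [hr.isSelfAdjoint.star_eq] at hrx

theorem compression_apply {φ : corner M r hr →ₗ[ℂ] ℂ} (hφ : IsPositive φ) (x : corner M r hr) :
    compression φ hφ x = φ x :=
  congrArg φ (Subtype.ext (mul_mul_eq_of_mem_corner x.2))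

end Corner

theorem continuous_ultraweak_vectorFunctional (η : H) :
    Continuous[ultraweakTopology M, inferInstance] (vectorFunctional M η) := by
  let ξ : ℕ → H := Pi.single 0 η
  have hξ : Summable fun n => ‖ξ n‖ ^ 2 :=
    summable_of_ne_finset_zero (s := {0}) fun n hn => by
      simp [ξ, Finset.notMem_singleton.1 hn]
  have hsum (x : Elem M) : ∑' n, ⟪ξ n, (x : H →L[ℂ] H) (ξ n)⟫_ℂ = vectorFunctional M η x := by
    rw [tsum_eq_single 0 fun n hn => by simp [ξ, hn]]
    simp [ξ, vectorFunctional_apply]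
  have hle : ultraweakTopology M ≤ TopologicalSpace.induced
      (fun x : Elem M => ∑' n, ⟪ξ n, (x : H →L[ℂ] H) (ξ n)⟫_ℂ) inferInstance :=
    iInf_le_of_le ξ <| iInf_le_of_le ξ <| iInf_le_of_le hξ <| iInf_le_of_le hξ le_rfl
  rw [continuous_iff_le_induced]
  simpa only [hsum] using hle

theorem isNormal_comp_subtype {N : NonUnitalStarSubalgebra ℂ (Elem M)} {ψ : Elem M →ₗ[ℂ] ℂ}
    (hψ : Continuous[ultraweakTopology M, inferInstance] ψ) :
    IsNormal (N := N) (ψ ∘ₗ N.toSubmodule.subtype) := by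
  let _ : TopologicalSpace (Elem M) := ultraweakTopology M
  exact hψ.comp continuous_induced_dom

theorem IsSingular.map_eq_zero_of_le_vectorFunctional {r : Elem M} {hr : IsStarProjection r}
    {φ : corner M r hr →ₗ[ℂ] ℂ} (hφ : IsSingular φ) {h : corner M r hr}
    (hh : 0 ≤ (h : Elem M)) {ξ : H} (hle : ∀ y, 0 ≤ y → y ≤ (h : Elem M) →
      (compression φ hφ.1 y).re ≤ (vectorFunctional M ξ y).re) : φ h = 0 := by
  obtain ⟨η, hη, hηle⟩ := exists_inner_eq_vectorFunctional_le hh hle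
  have hzero := hφ.2 _
    (fun z => (vectorFunctional M η).map_nonneg (star_mul_self_nonneg (z : Elem M)))
    (isNormal_comp_subtype (continuous_ultraweak_vectorFunctional η)) fun z => by
      rw [LinearMap.sub_apply, ← compression_apply hφ.1, sub_nonneg]
      exact hηle z
  have hhη : ((h : Elem M) : H →L[ℂ] H) η = 0 := by
    have happ : vectorFunctional M η (star h * h) = 0 := congr($hzero (star h * h))
    simpa [vectorFunctional_star_mul_self] using happ
  have hadj : ContinuousLinearMap.adjoint ((h : Elem M) : H →L[ℂ] H) = (h : Elem M) :=
    congr(Subtype.val $(hh.star_eq))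
  rw [← compression_apply hφ.1, hη, ← ContinuousLinearMap.adjoint_inner_left, hadj, hhη,
    inner_zero_left]

theorem vectorFunctional_smul (t : ℝ) (ξ : H) (x : Elem M) :
    vectorFunctional M ((t : ℂ) • ξ) x = ((t ^ 2 : ℝ) : ℂ) * vectorFunctional M ξ x := by
  simp only [vectorFunctional_apply, map_smul, inner_smul_left, inner_smul_right,
    Complex.conj_ofReal]
  push_cast
  ring

theorem IsSingular.exists_le_map_eq_zero {r : Elem M} {hr : IsStarProjection r}
    {φ : corner M r hr →ₗ[ℂ] ℂ} (hφ : IsSingular φ) {a : Elem M} (ha : a ∈ corner M r hr)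
    (ha0 : 0 ≤ a) (ξ : H) {ε : ℝ} (hε : 0 < ε) :
    ∃ x : corner M r hr, 0 ≤ (x : Elem M) ∧ (x : Elem M) ≤ a ∧
      (vectorFunctional M ξ (a - x)).re ≤ ε ∧ φ x = 0 := by
  -- Replacing `ξ` by `√c • ξ` multiplies its vector functional by `c`.
  let c : ℝ := (compression φ hφ.1 a).re / ε + 1
  have hφa : 0 ≤ (compression φ hφ.1 a).re := ((compression φ hφ.1).map_nonneg ha0).1
  have hc : 0 < c := by positivity
  obtain ⟨x, hx0, hxa, hx, hle⟩ :=
    exists_le_forall_map_le_vectorFunctional (compression φ hφ.1) ha0 ((√c : ℂ) • ξ)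
  refine ⟨⟨x, mem_corner_of_le ha hx0 hxa⟩, hx0, hxa, ?_,
    hφ.map_eq_zero_of_le_vectorFunctional hx0 hle⟩
  rw [vectorFunctional_smul, Complex.re_ofReal_mul, Real.sq_sqrt hc.le] at hx
  refine le_of_mul_le_mul_left (hx.trans ?_) hc
  rw [add_mul, div_mul_cancel₀ _ hε.ne']
  simpa using hε.le

/- The instance `hE` is an explicit argument because on `WeakDual ℂ A` it is no longer found by
unification once the real module structure is fixed by `X`. -/
theorem exists_forall_lt_of_forall_exists_lt {E F : Type*} [TopologicalSpace E] [AddCommGroup E]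
    [Module ℝ E] [IsTopologicalAddGroup E] (hE : ContinuousSMul ℝ E) [TopologicalSpace F]
    [AddCommGroup F] [Module ℝ F] [IsTopologicalAddGroup F] [ContinuousSMul ℝ F] {X : Set E}
    {Y : Set F} (hne : X.Nonempty) (hX : IsCompact X) (hXc : Convex ℝ X) (hY : Convex ℝ Y)
    (B : E →ₗ[ℝ] F →ₗ[ℝ] ℝ) (hB : ∀ y, Continuous fun x => B x y) (hB' : ∀ x, Continuous (B x))
    {t : ℝ} (h : ∀ x ∈ X, ∃ y ∈ Y, B x y < t) : ∃ y ∈ Y, ∀ x ∈ X, B x y < t := by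
  obtain ⟨s, hsY, hs, hXs⟩ := hX.elim_finite_subcover_image (b := Y) (c := fun y => {x | B x y < t})
    (fun y _ => isOpen_lt (hB y) continuous_const) fun x hx => Set.mem_iUnion₂.2 <| by
      simpa using h x hx
  obtain ⟨y, hy, hyX⟩ := Sion.exists_lt_iInf_of_lt_iInf_of_finite (X := X) (Y := Y)
    (f := fun x y => -B x y) hne hX
    (fun y _ => (hB y).neg.lowerSemicontinuous.lowerSemicontinuousOn _)
    (fun y _ => (-B.flip y).convexOn hXc |>.quasiconvexOn) hY
    (fun x _ => (hB' x).neg.upperSemicontinuous.upperSemicontinuousOn _)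
    (fun x _ => (-B x).concaveOn hY |>.quasiconcaveOn) hXc hs hsY (t := -t)
    (fun x hx => by simpa using hXs hx)
  exact ⟨y, hy, fun x hx => neg_lt_neg_iff.1 (hyX x hx)⟩

theorem convex_setOf_re_vectorFunctional_sub_le (a : Elem M) (ξ : H) (ε : ℝ) :
    Convex ℝ {x : Elem M | (vectorFunctional M ξ (a - x)).re ≤ ε} := by
  have hlin : IsLinearMap ℝ fun x : Elem M => (vectorFunctional M ξ x).re :=
    ⟨fun x y => by rw [map_add, Complex.add_re], fun c x => by
      rw [PositiveLinearMap.map_smul_of_tower, Complex.smul_re]⟩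
  simpa only [map_sub, Complex.sub_re, sub_le_comm] using
    convex_halfSpace_ge hlin ((vectorFunctional M ξ a).re - ε)

section CompactConvex

variable {r : Elem M} {hr : IsStarProjection r} {K : Set (WeakDual ℂ (Elem M))} {a : Elem M}

theorem exists_le_forall_re_map_lt (hKcompact : IsCompact K) (hKconvex : Convex ℝ K)
    (hKsing : ∀ μ ∈ K, IsSingular (restrict (corner M r hr) μ)) (ha : a ∈ corner M r hr)
    (ha0 : 0 ≤ a) (ξ : H) {ε δ : ℝ} (hε : 0 < ε) (hδ : 0 < δ) :
    ∃ x, 0 ≤ x ∧ x ≤ a ∧ (vectorFunctional M ξ (a - x)).re ≤ ε ∧ ∀ μ ∈ K, (μ x).re < δ := by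
  rcases K.eq_empty_or_nonempty with rfl | hne
  · exact ⟨a, ha0, le_rfl, by simpa using hε.le, by simp⟩
  let Y : Set (Elem M) := Set.Icc 0 a ∩ {x | (vectorFunctional M ξ (a - x)).re ≤ ε}
  let B : WeakDual ℂ (Elem M) →ₗ[ℝ] Elem M →ₗ[ℝ] ℝ := LinearMap.mk₂ ℝ (fun μ x => (μ x).re)
    (fun μ ν x => Complex.add_re (μ x) (ν x)) (fun c μ x => Complex.smul_re c (μ x))
    (fun μ x y => by rw [map_add, Complex.add_re])
    (fun c μ x => by
      rw [← Complex.smul_re]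
      exact congrArg Complex.re ((WeakDual.toStrongDual μ).map_smul_of_tower c x))
  have hpointwise : ∀ μ ∈ K, ∃ x ∈ Y, B μ x < δ := fun μ hμ => by
    obtain ⟨x, hx0, hxa, hx, hμx⟩ := (hKsing μ hμ).exists_le_map_eq_zero ha ha0 ξ hε
    refine ⟨x, ⟨⟨hx0, hxa⟩, hx⟩, ?_⟩
    change (μ x).re < δ
    rwa [show μ x = 0 from hμx, Complex.zero_re]
  have hY : Convex ℝ Y := (convex_Icc 0 a).inter (convex_setOf_re_vectorFunctional_sub_le a ξ ε)
  have hsmul : ContinuousSMul ℝ (WeakDual ℂ (Elem M)) := inferInstance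
  obtain ⟨x, ⟨⟨hx0, hxa⟩, hx⟩, hxK⟩ := exists_forall_lt_of_forall_exists_lt hsmul hne
    hKcompact hKconvex hY B
    (fun x => Complex.continuous_re.comp (WeakDual.eval_continuous x))
    (fun μ => Complex.continuous_re.comp (WeakDual.toStrongDual μ).continuous) hpointwise
  exact ⟨x, hx0, hxa, hx, hxK⟩

theorem exists_antitone_forall_re_map_lt (hKcompact : IsCompact K) (hKconvex : Convex ℝ K)
    (hKsing : ∀ μ ∈ K, IsSingular (restrict (corner M r hr) μ)) (ha : a ∈ corner M r hr)
    (ha0 : 0 ≤ a) (ξ : H) {c : ℝ} (hc : 0 < c) :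
    ∃ x : ℕ → Elem M, Antitone x ∧ x 0 = a ∧ (∀ n, 0 ≤ x n) ∧
      (∀ n, (vectorFunctional M ξ (a - x n)).re ≤ c * (1 - (1 / 2) ^ n)) ∧
      ∀ n, ∀ μ ∈ K, (μ (x (n + 1))).re < (1 / 2) ^ n := by
  have hstep (n : ℕ) (u : Set.Icc 0 a) : ∃ v : Set.Icc 0 a, (v : Elem M) ≤ u ∧
      (vectorFunctional M ξ (u - v)).re ≤ c * (1 / 2) ^ (n + 1) ∧
      ∀ μ ∈ K, (μ v).re < (1 / 2) ^ n := by
    obtain ⟨v, hv0, hvu, hv⟩ := exists_le_forall_re_map_lt hKcompact hKconvex hKsing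
      (mem_corner_of_le ha u.2.1 u.2.2) u.2.1 ξ
      (show 0 < c * (1 / 2) ^ (n + 1) by positivity) (show (0 : ℝ) < (1 / 2) ^ n by positivity)
    exact ⟨⟨v, hv0, hvu.trans u.2.2⟩, hvu, hv⟩
  choose next hle hloss hsmall using hstep
  obtain ⟨x, hx0, hxsucc⟩ : ∃ x : ℕ → Set.Icc 0 a, x 0 = ⟨a, ha0, le_rfl⟩ ∧
      ∀ n, x (n + 1) = next n (x n) :=
    ⟨fun n => Nat.rec ⟨a, ha0, le_rfl⟩ next n, rfl, fun _ => rfl⟩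
  refine ⟨fun n => (x n).1, antitone_nat_of_succ_le fun n => ?_, congrArg _ hx0,
    fun n => (x n).2.1, fun n => ?_, fun n => ?_⟩
  · rw [hxsucc]
    exact hle n (x n)
  · induction n with
    | zero => simp [hx0]
    | succ n ih =>
      simp only [hxsucc]
      calc (vectorFunctional M ξ (a - next n (x n))).re
          = (vectorFunctional M ξ (a - x n)).re
            + (vectorFunctional M ξ (x n - next n (x n))).re := by
            rw [← Complex.add_re, ← map_add, sub_add_sub_cancel]
        _ ≤ c * (1 - (1 / 2) ^ n) + c * (1 / 2) ^ (n + 1) := add_le_add ih (hloss n (x n))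
        _ = c * (1 - (1 / 2) ^ (n + 1)) := by ring
  · simp only [hxsucc]
    exact hsmall n (x n)

theorem exists_ne_zero_forall_map_eq_zero (hKcompact : IsCompact K) (hKconvex : Convex ℝ K)
    (hKsing : ∀ μ ∈ K, IsSingular (restrict (corner M r hr) μ)) (ha : a ∈ corner M r hr)
    (ha0 : 0 ≤ a) (hne : a ≠ 0) : ∃ x, 0 ≤ x ∧ x ≤ a ∧ x ≠ 0 ∧ ∀ μ ∈ K, μ x = 0 := by
  obtain ⟨ξ, hξ⟩ := exists_re_vectorFunctional_pos ha0 hne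
  obtain ⟨x, hanti, hxa, hx0, hloss, hsmall⟩ :=
    exists_antitone_forall_re_map_lt hKcompact hKconvex hKsing ha ha0 ξ (half_pos hξ)
  obtain ⟨y, hglb, hlim⟩ := exists_isGLB_tendsto_of_antitone hanti hx0
  have hy0 : 0 ≤ y := hglb.2 (Set.forall_mem_range.2 hx0)
  have hyx (n : ℕ) : y ≤ x n := hglb.1 ⟨n, rfl⟩
  refine ⟨y, hy0, (hyx 0).trans_eq hxa, ?_, fun μ hμ => ?_⟩
  · have hlarge (n : ℕ) : (vectorFunctional M ξ a).re / 2 ≤ (vectorFunctional M ξ (x n)).re := by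
      have hn : 0 < (vectorFunctional M ξ a).re / 2 * (1 / 2) ^ n := by positivity
      have := hloss n
      rw [map_sub, Complex.sub_re] at this
      linarith
    have hylarge : (vectorFunctional M ξ a).re / 2 ≤ (vectorFunctional M ξ y).re :=
      ge_of_tendsto' ((Complex.continuous_re.tendsto _).comp
        (tendsto_const_nhds.inner (hlim ξ))) hlarge
    rintro rfl
    rw [map_zero, Complex.zero_re] at hylarge
    linarith
  · have hpos := (hKsing μ hμ).1
    have hxr (n : ℕ) : x n ∈ corner M r hr :=
      mem_corner_of_le ha (hx0 n) ((hanti n.zero_le).trans_eq hxa)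
    have hyr : y ∈ corner M r hr := mem_corner_of_le (hxr 0) hy0 (hyx 0)
    have hμy : 0 ≤ μ y := hpos.map_nonneg (x := ⟨y, hyr⟩) hy0
    have hμyx (n : ℕ) : μ y ≤ μ (x n) := hpos.map_mono (x := ⟨y, hyr⟩) (y := ⟨x n, hxr n⟩) (hyx n)
    have hre : (μ y).re ≤ 0 := ge_of_tendsto'
      (tendsto_pow_atTop_nhds_zero_of_lt_one (r := (1 / 2 : ℝ)) (by norm_num) (by norm_num))
      fun n => (hμyx (n + 1)).1.trans (hsmall n μ hμ).le
    exact Complex.ext (le_antisymm hre hμy.1) hμy.2.symm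

end CompactConvex

theorem starProjection_topologicalClosure_range_mem (a : Elem M) :
    (a : H →L[ℂ] H).range.topologicalClosure.starProjection ∈ M := by
  rw [VonNeumannAlgebra.IsStarProjection.mem_iff isStarProjection_starProjection]
  intro y hy
  rw [Submodule.range_starProjection]
  refine fun v hv => map_mem_closure (s := ((a : H →L[ℂ] H).range : Set H)) y.continuous hv ?_
  rintro _ ⟨w, rfl⟩
  exact ⟨y w, congr($((commute_of_mem a.2 hy).eq) w)⟩

theorem exists_range_projection (a : Elem M) :
    ∃ p : Elem M, IsStarProjection p ∧ p * a = a ∧ ∀ b : Elem M, b * a = 0 → b * p = 0 := by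
  let U := (a : H →L[ℂ] H).range.topologicalClosure
  have hU : IsStarProjection U.starProjection := isStarProjection_starProjection
  refine ⟨⟨U.starProjection, starProjection_topologicalClosure_range_mem a⟩,
    ⟨Subtype.ext hU.isIdempotentElem, Subtype.ext hU.isSelfAdjoint⟩,
    Subtype.ext (ContinuousLinearMap.ext fun v => ?_),
    fun b hb => Subtype.ext (ContinuousLinearMap.ext fun v => ?_)⟩
  · exact Submodule.starProjection_eq_self_iff.2 (Submodule.le_topologicalClosure _ ⟨v, rfl⟩)
  · have hle : U ≤ (b : H →L[ℂ] H).ker := by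
      refine Submodule.topologicalClosure_minimal _ ?_ (b : H →L[ℂ] H).isClosed_ker
      rintro _ ⟨w, rfl⟩
      exact congr(Subtype.val $hb w)
    exact hle (U.starProjection_apply_mem v)

theorem exists_smul_projection_le {x : Elem M} (hx : 0 ≤ x) (hne : x ≠ 0) :
    ∃ c : ℝ, 0 < c ∧ ∃ p : Elem M, IsStarProjection p ∧ p ≠ 0 ∧ c • p ≤ x := by
  let c := ‖x‖ / 2
  have hc : 0 < c := half_pos (norm_pos_iff.2 hne)
  obtain ⟨p, hp, hpos, hneg⟩ := exists_range_projection (x - c • 1)⁺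
  refine ⟨c, hc, p, hp, ?_, smul_le_of_mul_posPart_eq hx hp c hpos
    (hneg _ (CFC.negPart_mul_posPart _))⟩
  rintro rfl
  have hd : IsSelfAdjoint (x - c • 1) := hx.isSelfAdjoint.sub (.smul (.all c) (.one _))
  rw [zero_mul, eq_comm, CFC.posPart_eq_zero_iff _ hd, sub_nonpos, ← Algebra.algebraMap_eq_smul_one,
    ← CStarAlgebra.norm_le_iff_le_algebraMap x hc.le] at hpos
  exact (half_lt_self (norm_pos_iff.2 hne)).not_ge hpos

theorem map_eq_zero_of_smul_le {r : Elem M} {hr : IsStarProjection r} {μ : WeakDual ℂ (Elem M)}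
    (hμ : IsPositive (restrict (corner M r hr) μ)) {p x : Elem M} {c : ℝ} (hc : 0 < c)
    (hp : 0 ≤ p) (hpx : c • p ≤ x) (hx : x ∈ corner M r hr) (hμx : μ x = 0) : μ p = 0 := by
  have hcp : 0 ≤ c • p := smul_nonneg hc.le hp
  have hcpr : c • p ∈ corner M r hr := mem_corner_of_le hx hcp hpx
  have hμcp : μ (c • p) = 0 := le_antisymm
    ((hμ.map_mono (x := ⟨c • p, hcpr⟩) (y := ⟨x, hx⟩) hpx).trans_eq hμx)
    (hμ.map_nonneg (x := ⟨c • p, hcpr⟩) hcp)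
  have hsmul : μ (c • p) = c • μ p := (WeakDual.toStrongDual μ).map_smul_of_tower c p
  exact (smul_eq_zero_iff_right hc.ne').1 (hsmul.symm.trans hμcp)

end VNA

open scoped VNA in
theorem lemma3p4_general {H : Type*} [NormedAddCommGroup H] [InnerProductSpace ℂ H]
    [CompleteSpace H] (M : VonNeumannAlgebra H) (r : VNA.Elem M) (hr : IsStarProjection r)
    (K : Set (WeakDual ℂ (VNA.Elem M))) (hKcompact : IsCompact K) (hKconvex : Convex ℝ K)
    (hKsing : ∀ μ ∈ K, VNA.IsSingular (VNA.restrict (VNA.corner M r hr) μ)) :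
    ∀ f ∈ VNA.corner M r hr, IsStarProjection f → f ≠ 0 →
      ∃ p : VNA.Elem M, IsStarProjection p ∧ p ≠ 0 ∧ p ≤ f ∧ ∀ μ ∈ K, μ p = 0 := by
  intro f hfr hf hf0
  obtain ⟨x, hx0, hxf, hxne, hKx⟩ :=
    VNA.exists_ne_zero_forall_map_eq_zero hKcompact hKconvex hKsing hfr hf.nonneg hf0
  obtain ⟨c, hc, p, hp, hp0, hpx⟩ := VNA.exists_smul_projection_le hx0 hxne
  have hpf : p ≤ f := VNA.le_of_smul_le_projection hf hp hc (hpx.trans hxf)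
  have hxr : x ∈ VNA.corner M r hr := VNA.mem_corner_of_le hfr hx0 hxf
  exact ⟨p, hp, hp0, hpf, fun μ hμ =>
    VNA.map_eq_zero_of_smul_le (hKsing μ hμ).1 hc hp.nonneg hpx hxr (hKx μ hμ)⟩

theorem lemma3p4 {H : Type*} [NormedAddCommGroup H] [InnerProductSpace ℂ H] [CompleteSpace H]
    (M : VonNeumannAlgebra H) (τ : VNA.Elem M → ENNReal) (hτ : VNA.IsFNSTrace M τ)
    (r : VNA.Elem M) (hr : IsStarProjection r) (hr0 : r ≠ 0)
    (K : Set (WeakDual ℂ (VNA.Elem M))) (hKball : K ⊆ VNA.positiveUnitBall M)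
    (hKcompact : IsCompact K) (hKconvex : Convex ℝ K)
    (hKsing : ∀ μ ∈ K, VNA.IsSingular (VNA.restrict (VNA.corner M r hr) μ)) :
    ∀ f ∈ VNA.corner M r hr, IsStarProjection f → f ≠ 0 →
      ∃ p : VNA.Elem M, IsStarProjection p ∧ p ≠ 0 ∧ p ≤ f ∧ ∀ μ ∈ K, μ p = 0 := by
  exact lemma3p4_general M r hr K hKcompact hKconvex hKsing
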